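/- Let $N\in\mathbb N$, $S_0>0$, $\Delta t>0$, $r\in\mathbb R$ and $0<\sigma<\frac{1}{2\Delta t}$. Put $\rho(y)=e^{\sigma y-r\Delta t}-1$, $\rho^+=\max(\rho,0)$, $\rho^-=\max(-\rho,0)$, $d=-\frac{r\Delta t}{\sigma}$, $\Omega^-=\{\rho\le 0\}=(-\infty,-d]$, $\Omega^+=\{\rho>0\}=(-d,\infty)$. Let $P$ be the normal law on $\mathbb R$ with mean $0$ and variance $\Delta t$, let $P^\pm$ be its restrictions to $\Omega^\pm$, and let $\mu=P^-\times P^+$ on $\Omega^-\times\Omega^+$. Let $M_1$ be the set of measures $Q$ on $\mathbb R$ of the form $$Q(A)=\int \chi_A(y_1)\,\alpha(y_1,y_2)\frac{\rho^+(y_2)}{\rho^-(y_1)+\rho^+(y_2)}\,d\mu(y_1,y_2)+\int \chi_A(y_2)\,\alpha(y_1,y_2)\frac{\rho^-(y_1)}{\rho^-(y_1)+\rho^+(y_2)}\,d\mu(y_1,y_2),$$ where $\alpha\ge 0$ is measurable, $\mu(\{\alpha>0\})=P(\Omega^+)P(\Omega^-)$, $\int\alpha\,\frac{\rho^-(y_1)\rho^+(y_2)}{\rho^-(y_1)+\rho^+(y_2)}\,d\mu<\infty$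 and $\int\alpha\,d\mu=1$. Let $M^N$ be the set of products $Q_1\times\dots\times Q_N$ with all $Q_i\in M_1$, and let $M_0^N$ be the convex span of $M^N$. For $y=(y_1,\dots,y_N)\in\mathbb R^N$ let $\zeta_n=y_1+\dots+y_n$, and let the discounted price of the risk asset be the discrete geometric Brownian motion $S_n=S_0e^{\sigma\zeta_n-nr\Delta t}$. Let $f$ be a Borel measurable payment function such that $f(S_N)$ is integrable with respect to every $Q\in M_0^N$ and $\sup_{Q\in M_0^N}E^Qf(S_N)<\infty$. Suppose that $f$ has no upward spikes on null sets, that is, for all $x>0$ and $\varepsilon,\delta>0$ the set $\{z: |z-x|<\delta,\ f(z)>f(x)-\varepsilon\}$ has positive Lebesgue measure (this holds, for instance, if $f$ is continuous, lower semicontinuous, one-sidedly continuous or monotone on $(0,\infty)$). Then the super-hedge fair price $\sup_{Q\in M_0^N}E^Qf(S_N)$ is given by $$\sup_{Q\in M_0^N}E^Qf(S_N)=\sup_{y_s^1\le -d<y_s^2,\ s=1,\dots,N}\ \sum_{i_1,\dots,i_N=1}^{2} f\Big(S_0\prod_{s=1}^N\big(1+\rho(y_s^{i_s})\big)\Big)\prod_{s=1}^N\frac{\big|e^{\sigma(d+y_s^{i_s+1})}-1\big|}{\big|e^{\sigma(d+y_s^{i_s+1})}-e^{\sigma(d+y_s^{i_s})}\big|},$$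 where $y_s^3=y_s^1$; in particular the right-hand side is finite. -/

import Mathlib

open MeasureTheory ProbabilityTheory

noncomputable section

namespace DiscreteGBM

/-- The law of one increment: the centred normal distribution with variance `Δt`. -/
def incrementLaw (Δt : ℝ) : Measure ℝ := gaussianReal 0 Δt.toNNReal

/-- The one-period return `ρ(y) = e^{σ y - r Δt} - 1`. -/
def ret (σ r Δt y : ℝ) : ℝ := Real.exp (σ * y - r * Δt) - 1

/-- The set of increments with a nonpositive return. -/
def omegaMinus (σ r Δt : ℝ) : Set ℝ := {y | ret σ r Δt y ≤ 0}

/-- The set of increments with a positive return. -/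
def omegaPlus (σ r Δt : ℝ) : Set ℝ := {y | 0 < ret σ r Δt y}

/-- The product `P⁻ × P⁺` of the restrictions of the increment law to the two sets. -/
def pairMeasure (σ r Δt : ℝ) : Measure (ℝ × ℝ) :=
  ((incrementLaw Δt).restrict (omegaMinus σ r Δt)).prod
    ((incrementLaw Δt).restrict (omegaPlus σ r Δt))

/-- The weight `ρ⁺(y₂) / (ρ⁻(y₁) + ρ⁺(y₂))` of the first point. -/
def weightMinus (σ r Δt : ℝ) (p : ℝ × ℝ) : ℝ :=
  max (ret σ r Δt p.2) 0 / (max (-ret σ r Δt p.1) 0 + max (ret σ r Δt p.2) 0)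

/-- The weight `ρ⁻(y₁) / (ρ⁻(y₁) + ρ⁺(y₂))` of the second point. -/
def weightPlus (σ r Δt : ℝ) (p : ℝ × ℝ) : ℝ :=
  max (-ret σ r Δt p.1) 0 / (max (-ret σ r Δt p.1) 0 + max (ret σ r Δt p.2) 0)

/-- Admissible mixing densities `α` on the product of the two sets. -/
structure IsMixingDensity (σ r Δt : ℝ) (α : ℝ × ℝ → ℝ) : Prop where
  measurable : Measurable α
  nonneg : ∀ p, 0 ≤ α p
  positive : pairMeasure σ r Δt {p | 0 < α p} =
    incrementLaw Δt (omegaPlus σ r Δt) * incrementLaw Δt (omegaMinus σ r Δt)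
  finite : ∫⁻ p, ENNReal.ofReal (α p *
      (max (-ret σ r Δt p.1) 0 * max (ret σ r Δt p.2) 0 /
        (max (-ret σ r Δt p.1) 0 + max (ret σ r Δt p.2) 0))) ∂(pairMeasure σ r Δt) < ⊤
  total : ∫⁻ p, ENNReal.ofReal (α p) ∂(pairMeasure σ r Δt) = 1

/-- The set of one-period measures: mixtures of two-point measures with an admissible density. -/
def onePeriodMeasures (σ r Δt : ℝ) : Set (Measure ℝ) :=
  {Q | ∃ α : ℝ × ℝ → ℝ, IsMixingDensity σ r Δt α ∧ ∀ A : Set ℝ, MeasurableSet A →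
    Q A =
      ∫⁻ p, A.indicator 1 p.1 * ENNReal.ofReal (α p * weightMinus σ r Δt p)
          ∂(pairMeasure σ r Δt) +
      ∫⁻ p, A.indicator 1 p.2 * ENNReal.ofReal (α p * weightPlus σ r Δt p)
          ∂(pairMeasure σ r Δt)}

/-- The set of `N`-fold products of one-period measures. -/
def productMeasures (N : ℕ) (σ r Δt : ℝ) : Set (Measure (Fin N → ℝ)) :=
  {Q | ∃ q : Fin N → Measure ℝ, (∀ i, q i ∈ onePeriodMeasures σ r Δt) ∧ Q = Measure.pi q}

/-- The convex span of the product measures. -/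
def martingaleMeasures (N : ℕ) (σ r Δt : ℝ) : Set (Measure (Fin N → ℝ)) :=
  convexHull NNReal (productMeasures N σ r Δt)

/-- The random walk `ζ_n = y_1 + ⋯ + y_n` along a path of increments. -/
def walk {N : ℕ} (n : ℕ) (y : Fin N → ℝ) : ℝ :=
  ∑ i ∈ Finset.univ.filter (fun i : Fin N => (i : ℕ) < n), y i

/-- The discounted price `S_n = S_0 e^{σ ζ_n - n r Δt}`. -/
def price {N : ℕ} (S₀ σ r Δt : ℝ) (n : ℕ) (y : Fin N → ℝ) : ℝ :=
  S₀ * Real.exp (σ * walk n y - n * r * Δt)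

/-- The set of expectations `E^Q f(S_N)`, with `Q` in the convex span. -/
def expectations (N : ℕ) (S₀ σ r Δt : ℝ) (f : ℝ → ℝ) : Set ℝ :=
  {x | ∃ Q ∈ martingaleMeasures N σ r Δt, x = ∫ y, f (price S₀ σ r Δt N y) ∂Q}

/-- The number `d = - r Δt / σ`. -/
def shift (σ r Δt : ℝ) : ℝ := -(r * Δt) / σ

/-- The sum over all `2^N` branches determined by the points `y s 0`, `y s 1`.
Addition in `Fin 2` is cyclic. -/
def branchSum (N : ℕ) (S₀ σ r Δt : ℝ) (f : ℝ → ℝ) (y : Fin N → Fin 2 → ℝ) : ℝ :=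
  ∑ i : Fin N → Fin 2,
    f (S₀ * ∏ s, (1 + ret σ r Δt (y s (i s)))) *
      ∏ s, |Real.exp (σ * (shift σ r Δt + y s (i s + 1))) - 1| /
        |Real.exp (σ * (shift σ r Δt + y s (i s + 1))) -
          Real.exp (σ * (shift σ r Δt + y s (i s)))|

/-- The values of the branch sum over all points with `y s 0 ≤ -d < y s 1`. -/
def branchValues (N : ℕ) (S₀ σ r Δt : ℝ) (f : ℝ → ℝ) : Set ℝ :=
  {x | ∃ y : Fin N → Fin 2 → ℝ,
    (∀ s, y s 0 ≤ -shift σ r Δt ∧ -shift σ r Δt < y s 1) ∧ x = branchSum N S₀ σ r Δt f y}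

/-- No value of `f` at a positive price is an upward spike on a null set: near every `x > 0`,
`f` exceeds `f x - ε` on a set of positive Lebesgue measure. It holds, for instance, if `f` is
lower semicontinuous, right-continuous, left-continuous or monotone on the positive half-line. -/
def NoNullSpikes (f : ℝ → ℝ) : Prop :=
  ∀ x, 0 < x → ∀ ε, 0 < ε → ∀ δ, 0 < δ → 0 < volume {z | |z - x| < δ ∧ f x - ε < f z}

end DiscreteGBM

end

/-! For `N ≥ 1` both suprema equal the least `V` such that some line `V + m (x / S₀ - 1)` dominates
`f` on `(0, ∞)`, the value at `S₀` of the concave envelope of `f`. So a bound `V` on either family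
of values should produce such a line, and the line should bound the other family by `V`.

A line gives bounds because `S_N` has mean `S₀`, both under products of mixtures
(`integral_le_of_line`) and under the branch weights (`branchSum_le`): the line then averages to its
value `V` at `S₀`.

From branches to a line: a two-point step in the first period, with all later returns zero, gives
one inequality for each pair of prices on opposite sides of `S₀`, and `exists_slope` separates the
two sides (`exists_line_of_bddAbove_branchValues`).

From expectations to a line, point masses are not available. The first increment is instead spread
uniformly over each of two intervals, and the later ones are kept near `-d`, where the return
vanishes. Fubini freezes the later increments and leaves a small shift, which is sent to zero
(`two_intervals_le`). Separation bounds interval integrals of `f` by those of a line, Lebesgue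
differentiation makes this an almost everywhere bound (`exists_ae_le_line`), and the absence of null
spikes makes it hold everywhere (`NoNullSpikes.le_line`). The densities used vanish off a rectangle,
hence are not admissible; `integrable_and_integral_le_of_pairDensity` reaches them by perturbation.
-/

namespace DiscreteGBM

open scoped ENNReal Topology
open Filter

/-! ### Mixtures of two-point martingale laws. -/

section Mixture

variable {σ r Δt : ℝ}

lemma continuous_ret : Continuous (ret σ r Δt) := by
  unfold ret; fun_prop

lemma measurable_ret : Measurable (ret σ r Δt) := continuous_ret.measurable

lemma measurable_weightMinus : Measurable (weightMinus σ r Δt) := by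
  have := measurable_ret (σ := σ) (r := r) (Δt := Δt)
  unfold weightMinus; fun_prop

lemma measurable_weightPlus : Measurable (weightPlus σ r Δt) := by
  have := measurable_ret (σ := σ) (r := r) (Δt := Δt)
  unfold weightPlus; fun_prop

lemma weightMinus_nonneg (p : ℝ × ℝ) : 0 ≤ weightMinus σ r Δt p := by
  unfold weightMinus; positivity

lemma weightPlus_nonneg (p : ℝ × ℝ) : 0 ≤ weightPlus σ r Δt p := by
  unfold weightPlus; positivity

lemma measurableSet_omegaMinus : MeasurableSet (omegaMinus σ r Δt) :=
  measurableSet_le measurable_ret measurable_const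

lemma measurableSet_omegaPlus : MeasurableSet (omegaPlus σ r Δt) :=
  measurableSet_lt measurable_const measurable_ret

instance : IsProbabilityMeasure (incrementLaw Δt) := by
  unfold incrementLaw; infer_instance

instance : IsFiniteMeasure (pairMeasure σ r Δt) := by
  unfold pairMeasure; infer_instance

lemma ae_pairMeasure : ∀ᵐ p ∂(pairMeasure σ r Δt),
    ret σ r Δt p.1 ≤ 0 ∧ 0 < ret σ r Δt p.2 := by
  rw [pairMeasure, Measure.prod_restrict]
  filter_upwards [ae_restrict_mem (measurableSet_omegaMinus.prod measurableSet_omegaPlus)]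
    with p hp using hp

lemma pairMeasure_univ : pairMeasure σ r Δt Set.univ =
    incrementLaw Δt (omegaMinus σ r Δt) * incrementLaw Δt (omegaPlus σ r Δt) := by
  rw [pairMeasure, ← Set.univ_prod_univ, Measure.prod_prod]; simp

lemma weights_add {p : ℝ × ℝ} (h : ret σ r Δt p.1 ≤ 0 ∧ 0 < ret σ r Δt p.2) :
    weightMinus σ r Δt p + weightPlus σ r Δt p = 1 := by
  unfold weightMinus weightPlus
  rw [max_eq_left h.2.le, max_eq_left (by linarith [h.1])]
  have : -ret σ r Δt p.1 + ret σ r Δt p.2 ≠ 0 := by linarith [h.1, h.2]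
  field_simp; ring

/-- The weights are inversely proportional to the distances of the two returns from zero, so the
two-point law is a martingale step. -/
lemma weights_mean {p : ℝ × ℝ} (h : ret σ r Δt p.1 ≤ 0 ∧ 0 < ret σ r Δt p.2) :
    (1 + ret σ r Δt p.1) * weightMinus σ r Δt p +
      (1 + ret σ r Δt p.2) * weightPlus σ r Δt p = 1 := by
  unfold weightMinus weightPlus
  rw [max_eq_left h.2.le, max_eq_left (by linarith [h.1])]
  have : -ret σ r Δt p.1 + ret σ r Δt p.2 ≠ 0 := by linarith [h.1, h.2]
  field_simp; ring

/-- Probability densities on pairs, without the positivity required of admissible mixing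
densities. -/
structure IsPairDensity (σ r Δt : ℝ) (α : ℝ × ℝ → ℝ) : Prop where
  measurable : Measurable α
  nonneg : ∀ p, 0 ≤ α p
  total : ∫⁻ p, ENNReal.ofReal (α p) ∂(pairMeasure σ r Δt) = 1

/-- The mixture of two-point martingale laws with density `α`. -/
noncomputable def mixture (σ r Δt : ℝ) (α : ℝ × ℝ → ℝ) : Measure ℝ :=
  ((pairMeasure σ r Δt).withDensity
      fun p => ENNReal.ofReal (α p * weightMinus σ r Δt p)).map Prod.fst +
  ((pairMeasure σ r Δt).withDensity
      fun p => ENNReal.ofReal (α p * weightPlus σ r Δt p)).map Prod.snd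

lemma lintegral_mixture {α : ℝ × ℝ → ℝ} (hα : Measurable α) {g : ℝ → ℝ≥0∞}
    (hg : Measurable g) :
    ∫⁻ y, g y ∂(mixture σ r Δt α) =
      ∫⁻ p, g p.1 * ENNReal.ofReal (α p * weightMinus σ r Δt p) ∂(pairMeasure σ r Δt) +
      ∫⁻ p, g p.2 * ENNReal.ofReal (α p * weightPlus σ r Δt p) ∂(pairMeasure σ r Δt) := by
  have h1 := measurable_weightMinus (σ := σ) (r := r) (Δt := Δt)
  have h2 := measurable_weightPlus (σ := σ) (r := r) (Δt := Δt)
  rw [mixture, lintegral_add_measure, lintegral_map hg measurable_fst,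
    lintegral_map hg measurable_snd,
    lintegral_withDensity_eq_lintegral_mul _ (by fun_prop) (by fun_prop),
    lintegral_withDensity_eq_lintegral_mul _ (by fun_prop) (by fun_prop)]
  simp only [Pi.mul_apply, mul_comm]

lemma mixture_apply {α : ℝ × ℝ → ℝ} (hα : Measurable α) {A : Set ℝ} (hA : MeasurableSet A) :
    mixture σ r Δt α A =
      ∫⁻ p, A.indicator 1 p.1 * ENNReal.ofReal (α p * weightMinus σ r Δt p)
        ∂(pairMeasure σ r Δt) +
      ∫⁻ p, A.indicator 1 p.2 * ENNReal.ofReal (α p * weightPlus σ r Δt p)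
        ∂(pairMeasure σ r Δt) := by
  rw [← lintegral_indicator_one hA, lintegral_mixture hα (measurable_one.indicator hA)]

/-- A function averaging to one under every two-point law does so under the mixture. This serves
both for the total mass and for the mean price ratio. -/
lemma lintegral_mixture_eq_one {α : ℝ × ℝ → ℝ} (hα : IsPairDensity σ r Δt α) {g : ℝ → ℝ}
    (hg : Measurable g) (hg0 : ∀ y, 0 ≤ g y)
    (h : ∀ p : ℝ × ℝ, ret σ r Δt p.1 ≤ 0 ∧ 0 < ret σ r Δt p.2 →
      g p.1 * weightMinus σ r Δt p + g p.2 * weightPlus σ r Δt p = 1) :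
    ∫⁻ y, ENNReal.ofReal (g y) ∂(mixture σ r Δt α) = 1 := by
  have h1 := measurable_weightMinus (σ := σ) (r := r) (Δt := Δt)
  have hm := hα.measurable
  rw [lintegral_mixture hα.measurable (by fun_prop), ← lintegral_add_left (by fun_prop),
    ← hα.total]
  refine lintegral_congr_ae ?_
  filter_upwards [ae_pairMeasure] with p hp
  have ha := hα.nonneg p
  have hw := weightMinus_nonneg (σ := σ) (r := r) (Δt := Δt) p
  have hw' := weightPlus_nonneg (σ := σ) (r := r) (Δt := Δt) p
  rw [← ENNReal.ofReal_mul (hg0 _), ← ENNReal.ofReal_mul (hg0 _), ← ENNReal.ofReal_add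
    (mul_nonneg (hg0 _) (mul_nonneg ha hw)) (mul_nonneg (hg0 _) (mul_nonneg ha hw'))]
  congr 1
  linear_combination α p * h p hp

lemma isProbabilityMeasure_mixture {α : ℝ × ℝ → ℝ} (hα : IsPairDensity σ r Δt α) :
    IsProbabilityMeasure (mixture σ r Δt α) := by
  constructor
  have := lintegral_mixture_eq_one hα (g := fun _ => 1) measurable_const (fun _ => zero_le_one)
    fun p hp => by simpa using weights_add hp
  simpa using this

lemma one_add_ret (y : ℝ) : 1 + ret σ r Δt y = Real.exp (σ * y - r * Δt) := by
  unfold ret; ring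

lemma one_add_ret_pos (y : ℝ) : 0 < 1 + ret σ r Δt y := by
  rw [one_add_ret]; positivity

lemma lintegral_one_add_ret {α : ℝ × ℝ → ℝ} (hα : IsPairDensity σ r Δt α) :
    ∫⁻ y, ENNReal.ofReal (1 + ret σ r Δt y) ∂(mixture σ r Δt α) = 1 :=
  lintegral_mixture_eq_one hα (measurable_ret.const_add 1)
    (fun y => (one_add_ret_pos y).le) fun _ hp => weights_mean hp

lemma integrable_one_add_ret {α : ℝ × ℝ → ℝ} (hα : IsPairDensity σ r Δt α) :
    Integrable (fun y => 1 + ret σ r Δt y) (mixture σ r Δt α) := by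
  refine ⟨(measurable_ret.const_add 1).aestronglyMeasurable, ?_⟩
  rw [hasFiniteIntegral_iff_ofReal (ae_of_all _ fun y => (one_add_ret_pos y).le),
    lintegral_one_add_ret hα]
  exact ENNReal.one_lt_top

lemma integral_one_add_ret {α : ℝ × ℝ → ℝ} (hα : IsPairDensity σ r Δt α) :
    ∫ y, (1 + ret σ r Δt y) ∂(mixture σ r Δt α) = 1 := by
  rw [integral_eq_lintegral_of_nonneg_ae (ae_of_all _ fun y => (one_add_ret_pos y).le)
    (measurable_ret.const_add 1).aestronglyMeasurable, lintegral_one_add_ret hα]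
  simp

lemma IsMixingDensity.isPairDensity {α : ℝ × ℝ → ℝ} (hα : IsMixingDensity σ r Δt α) :
    IsPairDensity σ r Δt α := ⟨hα.measurable, hα.nonneg, hα.total⟩

/-- A positive pair density is admissible: the harmonic weight is at most `1`. -/
lemma IsPairDensity.isMixingDensity {α : ℝ × ℝ → ℝ} (hα : IsPairDensity σ r Δt α)
    (hpos : ∀ p, 0 < α p) : IsMixingDensity σ r Δt α where
  measurable := hα.measurable
  nonneg := hα.nonneg
  positive := by
    rw [show {p | 0 < α p} = Set.univ from Set.eq_univ_of_forall hpos, pairMeasure_univ, mul_comm]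
  total := hα.total
  finite := by
    refine lt_of_le_of_lt ?_ ENNReal.one_lt_top
    rw [← hα.total]
    refine lintegral_mono fun p => ENNReal.ofReal_le_ofReal ?_
    refine mul_le_of_le_one_right (hα.nonneg p) ?_
    have h1 : max (-ret σ r Δt p.1) 0 ≤ 1 :=
      max_le (by linarith [one_add_ret_pos (σ := σ) (r := r) (Δt := Δt) p.1]) zero_le_one
    have h2 : 0 ≤ max (-ret σ r Δt p.1) 0 := le_max_right _ _
    have h3 : 0 ≤ max (ret σ r Δt p.2) 0 := le_max_right _ _
    refine div_le_one_of_le₀ ?_ (by positivity)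
    nlinarith

lemma mem_onePeriodMeasures_iff {Q : Measure ℝ} : Q ∈ onePeriodMeasures σ r Δt ↔
    ∃ α, IsMixingDensity σ r Δt α ∧ Q = mixture σ r Δt α := by
  constructor
  · rintro ⟨α, hα, h⟩
    exact ⟨α, hα, Measure.ext fun A hA => by rw [h A hA, mixture_apply hα.measurable hA]⟩
  · rintro ⟨α, hα, rfl⟩
    exact ⟨α, hα, fun A hA => mixture_apply hα.measurable hA⟩

lemma mixture_combination {α β : ℝ × ℝ → ℝ} (hα : IsPairDensity σ r Δt α)
    (hβ : IsPairDensity σ r Δt β) {a b : ℝ} (ha : 0 ≤ a) (hb : 0 ≤ b) :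
    mixture σ r Δt (fun p => a * α p + b * β p) =
      ENNReal.ofReal a • mixture σ r Δt α + ENNReal.ofReal b • mixture σ r Δt β := by
  have h1 := measurable_weightMinus (σ := σ) (r := r) (Δt := Δt)
  have h2 := measurable_weightPlus (σ := σ) (r := r) (Δt := Δt)
  have hm := hα.measurable
  have hm' := hβ.measurable
  have key : ∀ w : ℝ × ℝ → ℝ, (∀ p, 0 ≤ w p) →
      (fun p => ENNReal.ofReal ((a * α p + b * β p) * w p)) =
      ENNReal.ofReal a • (fun p => ENNReal.ofReal (α p * w p)) +
        ENNReal.ofReal b • (fun p => ENNReal.ofReal (β p * w p)) := by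
    intro w hw
    ext p
    have := mul_nonneg (hα.nonneg p) (hw p)
    have := mul_nonneg (hβ.nonneg p) (hw p)
    simp only [Pi.add_apply, Pi.smul_apply, smul_eq_mul]
    rw [← ENNReal.ofReal_mul ha, ← ENNReal.ofReal_mul hb, ← ENNReal.ofReal_add (by positivity)
      (by positivity)]
    congr 1; ring
  unfold mixture
  rw [key _ weightMinus_nonneg, key _ weightPlus_nonneg,
    withDensity_add_left (by fun_prop), withDensity_add_left (by fun_prop),
    withDensity_smul _ (by fun_prop), withDensity_smul _ (by fun_prop),
    withDensity_smul _ (by fun_prop), withDensity_smul _ (by fun_prop),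
    Measure.map_add _ _ measurable_fst, Measure.map_add _ _ measurable_snd]
  simp only [Measure.map_smul, smul_add]
  abel

lemma IsPairDensity.combination {α β : ℝ × ℝ → ℝ} (hα : IsPairDensity σ r Δt α)
    (hβ : IsPairDensity σ r Δt β) {a b : ℝ} (ha : 0 ≤ a) (hb : 0 ≤ b) (hab : a + b = 1) :
    IsPairDensity σ r Δt (fun p => a * α p + b * β p) where
  measurable := (hα.measurable.const_mul a).add (hβ.measurable.const_mul b)
  nonneg p := add_nonneg (mul_nonneg ha (hα.nonneg p)) (mul_nonneg hb (hβ.nonneg p))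
  total := by
    have hm := hα.measurable
    have hm' := hβ.measurable
    have : ∀ p, ENNReal.ofReal (a * α p + b * β p) =
        ENNReal.ofReal a * ENNReal.ofReal (α p) + ENNReal.ofReal b * ENNReal.ofReal (β p) := by
      intro p
      rw [ENNReal.ofReal_add (mul_nonneg ha (hα.nonneg p)) (mul_nonneg hb (hβ.nonneg p)),
        ENNReal.ofReal_mul ha, ENNReal.ofReal_mul hb]
    simp_rw [this]
    rw [lintegral_add_left (by fun_prop), lintegral_const_mul _ (by fun_prop),
      lintegral_const_mul _ (by fun_prop), hα.total, hβ.total, mul_one, mul_one,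
      ← ENNReal.ofReal_add ha hb, hab, ENNReal.ofReal_one]

lemma ret_neg_shift (hσ : 0 < σ) : ret σ r Δt (-shift σ r Δt) = 0 := by
  rw [ret, shift, neg_div, neg_neg, mul_div_cancel₀ _ hσ.ne', sub_self, Real.exp_zero, sub_self]

lemma ret_strictMono (hσ : 0 < σ) : StrictMono (ret σ r Δt) := fun x y hxy => by
  have := mul_lt_mul_of_pos_left hxy hσ
  exact sub_lt_sub_right (Real.exp_lt_exp.2 (by linarith)) 1

lemma ret_neg_iff (hσ : 0 < σ) (y : ℝ) : ret σ r Δt y < 0 ↔ y < -shift σ r Δt := by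
  rw [← ret_neg_shift (r := r) (Δt := Δt) hσ, (ret_strictMono hσ).lt_iff_lt]

lemma ret_nonpos_iff (hσ : 0 < σ) (y : ℝ) : ret σ r Δt y ≤ 0 ↔ y ≤ -shift σ r Δt := by
  rw [← ret_neg_shift (r := r) (Δt := Δt) hσ, (ret_strictMono hσ).le_iff_le]

lemma ret_pos_iff (hσ : 0 < σ) (y : ℝ) : 0 < ret σ r Δt y ↔ -shift σ r Δt < y := by
  rw [← ret_neg_shift (r := r) (Δt := Δt) hσ, (ret_strictMono hσ).lt_iff_lt]

lemma omegaMinus_eq (hσ : 0 < σ) : omegaMinus σ r Δt = Set.Iic (-shift σ r Δt) :=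
  Set.ext fun y => ret_nonpos_iff hσ y

lemma omegaPlus_eq (hσ : 0 < σ) : omegaPlus σ r Δt = Set.Ioi (-shift σ r Δt) :=
  Set.ext fun y => ret_pos_iff hσ y

lemma pairMeasure_univ_ne_zero (hσ : 0 < σ) (hΔt : 0 < Δt) :
    pairMeasure σ r Δt Set.univ ≠ 0 := by
  have hac : volume ≪ incrementLaw Δt :=
    gaussianReal_absolutelyContinuous' 0 (by simpa using hΔt)
  rw [pairMeasure_univ, omegaMinus_eq hσ, omegaPlus_eq hσ]
  refine mul_ne_zero (fun h => ?_) fun h => ?_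
  · simpa using hac h
  · simpa using hac h

/-- A constant density is an admissible mixing density. -/
lemma exists_pos_pairDensity (hσ : 0 < σ) (hΔt : 0 < Δt) :
    ∃ α, IsPairDensity σ r Δt α ∧ ∀ p, 0 < α p := by
  have h0 := pairMeasure_univ_ne_zero (r := r) hσ hΔt
  have h1 : pairMeasure σ r Δt Set.univ ≠ ⊤ := measure_ne_top _ _
  have hpos : 0 < ((pairMeasure σ r Δt Set.univ)⁻¹).toReal :=
    ENNReal.toReal_pos (ENNReal.inv_ne_zero.2 h1) (ENNReal.inv_ne_top.2 h0)
  refine ⟨fun _ => ((pairMeasure σ r Δt Set.univ)⁻¹).toReal,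
    ⟨measurable_const, fun _ => hpos.le, ?_⟩, fun _ => hpos⟩
  rw [lintegral_const, ENNReal.ofReal_toReal (ENNReal.inv_ne_top.2 h0),
    ENNReal.inv_mul_cancel h0 h1]

end Mixture

/-! ### Laws uniform on each of two intervals. -/

section IntervalLaws

variable {σ r Δt : ℝ}

/-- Dividing by the Gaussian density turns the increment law into Lebesgue measure on `I`. -/
lemma lintegral_restrict_incrementLaw_div (hΔt : 0 < Δt) {I Ω : Set ℝ} (hI : MeasurableSet I)
    (hIΩ : I ⊆ Ω) {g : ℝ → ℝ≥0∞} (hg : Measurable g) :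
    ∫⁻ y, g y * ENNReal.ofReal (I.indicator (fun y => (gaussianPDFReal 0 Δt.toNNReal y)⁻¹) y)
      ∂((incrementLaw Δt).restrict Ω) = ∫⁻ y in I, g y := by
  have hv : Δt.toNNReal ≠ 0 := by simpa using hΔt
  have hpdf := measurable_gaussianPDFReal 0 Δt.toNNReal
  have hm : Measurable (I.indicator fun y => (gaussianPDFReal 0 Δt.toNNReal y)⁻¹) :=
    hpdf.inv.indicator hI
  rw [incrementLaw, gaussianReal_of_var_ne_zero 0 hv, restrict_withDensity',
    lintegral_withDensity_eq_lintegral_mul _ (measurable_gaussianPDF _ _) (by fun_prop)]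
  have : ∀ y, (gaussianPDF 0 Δt.toNNReal * fun y => g y * ENNReal.ofReal
      (I.indicator (fun y => (gaussianPDFReal 0 Δt.toNNReal y)⁻¹) y)) y = I.indicator g y := by
    intro y
    by_cases hy : y ∈ I
    · simp only [Pi.mul_apply, Set.indicator_of_mem hy, gaussianPDF]
      have hp := gaussianPDFReal_pos 0 Δt.toNNReal y hv
      rw [mul_left_comm, ← ENNReal.ofReal_mul hp.le, mul_inv_cancel₀ hp.ne']
      simp
    · simp [hy]
  simp_rw [this]
  rw [setLIntegral_indicator hI, Set.inter_eq_left.2 hIΩ]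

/-- Mixtures of two-point laws which are uniform on each of two intervals. -/
lemma exists_pairDensity_intervals (hσ : 0 < σ) (hΔt : 0 < Δt) {a b c d : ℝ} (hab : a < b)
    (hb : b < -shift σ r Δt) (hc : -shift σ r Δt < c) (hcd : c < d) :
    ∃ α, ∃ k : ℝ, IsPairDensity σ r Δt α ∧ 0 < k ∧
      0 < ∫ y in Set.Icc c d, ret σ r Δt y ∧ 0 < ∫ y in Set.Icc a b, -ret σ r Δt y ∧
      k * ((b - a) * (∫ y in Set.Icc c d, ret σ r Δt y) +
        (d - c) * ∫ y in Set.Icc a b, -ret σ r Δt y) = 1 ∧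
      mixture σ r Δt α =
        ENNReal.ofReal (k * ∫ y in Set.Icc c d, ret σ r Δt y) •
          volume.restrict (Set.Icc a b) +
        ENNReal.ofReal (k * ∫ y in Set.Icc a b, -ret σ r Δt y) •
          volume.restrict (Set.Icc c d) := by
  have hret := measurable_ret (σ := σ) (r := r) (Δt := Δt)
  have hpdf := measurable_gaussianPDFReal 0 Δt.toNNReal
  have hv : Δt.toNNReal ≠ 0 := by simpa using hΔt
  have hneg : ∀ y ∈ Set.Icc a b, 0 < -ret σ r Δt y := fun y hy =>
    neg_pos.2 ((ret_neg_iff hσ y).2 (hy.2.trans_lt hb))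
  have hpos : ∀ y ∈ Set.Icc c d, 0 < ret σ r Δt y := fun y hy =>
    (ret_pos_iff hσ y).2 (hc.trans_le hy.1)
  have hposI : ∀ {x y : ℝ} {g : ℝ → ℝ}, x < y → Continuous g → (∀ z ∈ Set.Icc x y, 0 < g z) →
      0 < ∫ z in Set.Icc x y, g z := by
    intro x y g hxy hg h
    rw [integral_Icc_eq_integral_Ioc, ← intervalIntegral.integral_of_le hxy.le]
    exact intervalIntegral.intervalIntegral_pos_of_pos_on (hg.intervalIntegrable _ _)
      (fun z hz => h z (Set.Ioo_subset_Icc_self hz)) hxy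
  have hlint : ∀ {x y : ℝ} {g : ℝ → ℝ}, Continuous g → (∀ z ∈ Set.Icc x y, 0 < g z) →
      ∫⁻ z in Set.Icc x y, ENNReal.ofReal (max (g z) 0) =
        ENNReal.ofReal (∫ z in Set.Icc x y, g z) := by
    intro x y g hg h
    rw [ofReal_integral_eq_lintegral_ofReal (hg.integrableOn_Icc)
      ((ae_restrict_iff' measurableSet_Icc).2 (ae_of_all _ fun z hz => (h z hz).le))]
    exact setLIntegral_congr_fun measurableSet_Icc fun z hz => by
      simp only [max_eq_left (h z hz).le]
  have hP := hposI hcd continuous_ret hpos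
  have hM : 0 < ∫ y in Set.Icc a b, -ret σ r Δt y := hposI hab continuous_ret.neg hneg
  have hlP := hlint continuous_ret hpos
  have hlM : ∫⁻ y in Set.Icc a b, ENNReal.ofReal (max (-ret σ r Δt y) 0) =
      ENNReal.ofReal (∫ y in Set.Icc a b, -ret σ r Δt y) := hlint continuous_ret.neg hneg
  set P := ∫ y in Set.Icc c d, ret σ r Δt y
  set M := ∫ y in Set.Icc a b, -ret σ r Δt y
  have hden : 0 < (b - a) * P + (d - c) * M :=
    add_pos (mul_pos (sub_pos.2 hab) hP) (mul_pos (sub_pos.2 hcd) hM)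
  obtain ⟨k, hk, hk1⟩ : ∃ k : ℝ, 0 < k ∧ k * ((b - a) * P + (d - c) * M) = 1 :=
    ⟨_, inv_pos.2 hden, inv_mul_cancel₀ hden.ne'⟩
  set φ : Set ℝ → ℝ → ℝ := fun I =>
    I.indicator fun y => (gaussianPDFReal 0 Δt.toNNReal y)⁻¹ with hφ
  have hφ0 : ∀ I y, 0 ≤ φ I y := fun I y =>
    Set.indicator_nonneg (fun z _ => inv_nonneg.2 (gaussianPDFReal_nonneg _ _ _)) y
  have hφm : ∀ x y : ℝ, Measurable (φ (Set.Icc x y)) := fun x y =>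
    hpdf.inv.indicator measurableSet_Icc
  have hφm1 := hφm a b
  have hφm2 := hφm c d
  -- The last factor cancels the denominator of both weights, so each integrand below splits into a
  -- function of `p.1` times a function of `p.2`; `k` normalises the total mass.
  set α : ℝ × ℝ → ℝ := fun p => k * (φ (Set.Icc a b) p.1 * φ (Set.Icc c d) p.2) *
    (max (-ret σ r Δt p.1) 0 + max (ret σ r Δt p.2) 0) with hα
  have hαm : Measurable α := by fun_prop
  have hα0 : ∀ p, 0 ≤ α p := fun p => by
    have := hφ0 (Set.Icc a b) p.1
    have := hφ0 (Set.Icc c d) p.2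
    have := hk.le
    simp only [hα]; positivity
  have hsubM : Set.Icc a b ⊆ omegaMinus σ r Δt := fun y hy => by
    have := hneg y hy
    change ret σ r Δt y ≤ 0
    linarith
  have hsubP : Set.Icc c d ⊆ omegaPlus σ r Δt := fun y hy => hpos y hy
  have hmix : mixture σ r Δt α = ENNReal.ofReal (k * P) • volume.restrict (Set.Icc a b) +
      ENNReal.ofReal (k * M) • volume.restrict (Set.Icc c d) := by
    refine Measure.ext fun A hA => ?_
    have hone : Measurable (A.indicator (1 : ℝ → ℝ≥0∞)) := measurable_one.indicator hA
    have e1 : ∫⁻ p, A.indicator 1 p.1 * ENNReal.ofReal (α p * weightMinus σ r Δt p)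
        ∂(pairMeasure σ r Δt) = ENNReal.ofReal (k * P) * volume.restrict (Set.Icc a b) A := by
      have : ∀ᵐ p ∂(pairMeasure σ r Δt),
          A.indicator 1 p.1 * ENNReal.ofReal (α p * weightMinus σ r Δt p) =
          ENNReal.ofReal k * ((A.indicator 1 p.1 * ENNReal.ofReal (φ (Set.Icc a b) p.1)) *
            (ENNReal.ofReal (max (ret σ r Δt p.2) 0) *
              ENNReal.ofReal (φ (Set.Icc c d) p.2))) := by
        filter_upwards [ae_pairMeasure] with p hp
        have hne : max (-ret σ r Δt p.1) 0 + max (ret σ r Δt p.2) 0 ≠ 0 := by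
          have : 0 < max (ret σ r Δt p.2) 0 := lt_max_of_lt_left hp.2
          positivity
        have : α p * weightMinus σ r Δt p = k * (φ (Set.Icc a b) p.1 *
            (max (ret σ r Δt p.2) 0 * φ (Set.Icc c d) p.2)) := by
          simp only [hα, weightMinus]; field_simp
        rw [this, ENNReal.ofReal_mul hk.le, ENNReal.ofReal_mul (hφ0 _ _),
          ENNReal.ofReal_mul (le_max_right _ _)]
        ring
      rw [lintegral_congr_ae this, lintegral_const_mul _ (by fun_prop), pairMeasure,
        lintegral_prod_mul
          (f := fun x => A.indicator 1 x * ENNReal.ofReal (φ (Set.Icc a b) x))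
          (g := fun y => ENNReal.ofReal (max (ret σ r Δt y) 0) *
            ENNReal.ofReal (φ (Set.Icc c d) y)) (by fun_prop) (by fun_prop),
        lintegral_restrict_incrementLaw_div hΔt measurableSet_Icc hsubM hone,
        lintegral_restrict_incrementLaw_div hΔt measurableSet_Icc hsubP (by fun_prop), hlP,
        lintegral_indicator_one hA, ENNReal.ofReal_mul hk.le]
      ring
    have e2 : ∫⁻ p, A.indicator 1 p.2 * ENNReal.ofReal (α p * weightPlus σ r Δt p)
        ∂(pairMeasure σ r Δt) = ENNReal.ofReal (k * M) * volume.restrict (Set.Icc c d) A := by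
      have : ∀ᵐ p ∂(pairMeasure σ r Δt),
          A.indicator 1 p.2 * ENNReal.ofReal (α p * weightPlus σ r Δt p) =
          ENNReal.ofReal k * ((ENNReal.ofReal (max (-ret σ r Δt p.1) 0) *
              ENNReal.ofReal (φ (Set.Icc a b) p.1)) *
            (A.indicator 1 p.2 * ENNReal.ofReal (φ (Set.Icc c d) p.2))) := by
        filter_upwards [ae_pairMeasure] with p hp
        have hne : max (-ret σ r Δt p.1) 0 + max (ret σ r Δt p.2) 0 ≠ 0 := by
          have : 0 < max (ret σ r Δt p.2) 0 := lt_max_of_lt_left hp.2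
          positivity
        have : α p * weightPlus σ r Δt p = k * (φ (Set.Icc c d) p.2 *
            (max (-ret σ r Δt p.1) 0 * φ (Set.Icc a b) p.1)) := by
          simp only [hα, weightPlus]; field_simp
        rw [this, ENNReal.ofReal_mul hk.le, ENNReal.ofReal_mul (hφ0 _ _),
          ENNReal.ofReal_mul (le_max_right _ _)]
        ring
      rw [lintegral_congr_ae this, lintegral_const_mul _ (by fun_prop), pairMeasure,
        lintegral_prod_mul
          (f := fun x => ENNReal.ofReal (max (-ret σ r Δt x) 0) *
            ENNReal.ofReal (φ (Set.Icc a b) x))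
          (g := fun y => A.indicator 1 y * ENNReal.ofReal (φ (Set.Icc c d) y))
          (by fun_prop) (by fun_prop),
        lintegral_restrict_incrementLaw_div hΔt measurableSet_Icc hsubP hone,
        lintegral_restrict_incrementLaw_div hΔt measurableSet_Icc hsubM (by fun_prop), hlM,
        lintegral_indicator_one hA, ENNReal.ofReal_mul hk.le]
      ring
    rw [mixture_apply hαm hA, e1, e2]
    rfl
  refine ⟨α, k, ⟨hαm, hα0, ?_⟩, hk, hP, hM, hk1, hmix⟩
  have hw := measurable_weightMinus (σ := σ) (r := r) (Δt := Δt)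
  -- The weights sum to one, so the mass of the density can be read off from the mixture.
  have htot : ∫⁻ p, ENNReal.ofReal (α p) ∂(pairMeasure σ r Δt) = mixture σ r Δt α Set.univ := by
    rw [mixture_apply hαm MeasurableSet.univ]
    simp only [Set.indicator_univ, Pi.one_apply, one_mul]
    rw [← lintegral_add_left (by fun_prop)]
    refine lintegral_congr_ae ?_
    filter_upwards [ae_pairMeasure] with p hp
    rw [← ENNReal.ofReal_add (mul_nonneg (hα0 p) (weightMinus_nonneg p))
      (mul_nonneg (hα0 p) (weightPlus_nonneg p)), ← mul_add, weights_add hp, mul_one]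
  rw [htot, hmix]
  simp only [Measure.add_apply, Measure.smul_apply, smul_eq_mul, Measure.restrict_apply_univ,
    Real.volume_Icc]
  rw [← ENNReal.ofReal_mul (by positivity), ← ENNReal.ofReal_mul (by positivity),
    ← ENNReal.ofReal_add (mul_nonneg (by positivity) (sub_pos.2 hab).le)
      (mul_nonneg (by positivity) (sub_pos.2 hcd).le), ENNReal.ofReal_eq_one]
  linarith

end IntervalLaws

/-! ### Dropping the positivity of the densities. -/

section Closure

/-- `Measure.pi` is additive and homogeneous in each factor. -/
lemma pi_update_combination {ι : Type*} [Fintype ι] [DecidableEq ι] {X : ι → Type*}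
    [∀ i, MeasurableSpace (X i)] (q : ∀ i, Measure (X i))
    [∀ i, SigmaFinite (q i)] (i : ι) (B C : Measure (X i)) [SigmaFinite B] [SigmaFinite C]
    (a b : ℝ≥0∞) [SigmaFinite (a • B + b • C)] :
    Measure.pi (Function.update q i (a • B + b • C)) =
      a • Measure.pi (Function.update q i B) + b • Measure.pi (Function.update q i C) := by
  have inst : ∀ (D : Measure (X i)) [SigmaFinite D] (j : ι),
      SigmaFinite (Function.update q i D j) := by
    intro D _ j
    rcases eq_or_ne j i with rfl | h
    · simpa
    · simp only [Function.update_of_ne h]; infer_instance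
  have prodU : ∀ (D : Measure (X i)) (s : ∀ i, Set (X i)),
      ∏ j, (Function.update q i D j) (s j) = D (s i) * ∏ j ∈ {i}ᶜ, q j (s j) := by
    intro D s
    rw [Fintype.prod_eq_mul_prod_compl i]
    congr 1
    · simp
    · exact Finset.prod_congr rfl fun j hj => by
        rw [Function.update_of_ne (by simpa using hj)]
  have := inst B
  have := inst C
  have := inst (a • B + b • C)
  refine Measure.pi_eq fun s _ => ?_
  simp only [Measure.add_apply, Measure.smul_apply, smul_eq_mul, Measure.pi_pi, prodU]
  ring

variable {σ r Δt : ℝ}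

/-- The positivity of the mixing densities may be dropped in bounds for expectations under
product measures. -/
lemma integrable_and_integral_le_of_pairDensity (hσ : 0 < σ) (hΔt : 0 < Δt) {N : ℕ}
    {F : (Fin N → ℝ) → ℝ} {V : ℝ}
    (h : ∀ q : Fin N → Measure ℝ, (∀ i, q i ∈ onePeriodMeasures σ r Δt) →
      Integrable F (Measure.pi q) ∧ ∫ y, F y ∂(Measure.pi q) ≤ V)
    {α : Fin N → ℝ × ℝ → ℝ} (hα : ∀ i, IsPairDensity σ r Δt (α i)) :
    Integrable F (Measure.pi fun i => mixture σ r Δt (α i)) ∧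
      ∫ y, F y ∂(Measure.pi fun i => mixture σ r Δt (α i)) ≤ V := by
  obtain ⟨α₀, hα₀, hpos⟩ := exists_pos_pairDensity (r := r) hσ hΔt
  -- Induction on the set `s` of coordinates whose density may vanish somewhere.
  suffices H : ∀ s : Finset (Fin N), ∀ α : Fin N → ℝ × ℝ → ℝ,
      (∀ i, IsPairDensity σ r Δt (α i)) → (∀ i ∉ s, ∀ p, 0 < α i p) →
      Integrable F (Measure.pi fun i => mixture σ r Δt (α i)) ∧
        ∫ y, F y ∂(Measure.pi fun i => mixture σ r Δt (α i)) ≤ V from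
    H Finset.univ α hα fun i hi => absurd (Finset.mem_univ i) hi
  intro s
  induction s using Finset.induction_on with
  | empty =>
    intro α hα hp
    exact h _ fun i => mem_onePeriodMeasures_iff.2
      ⟨α i, (hα i).isMixingDensity (hp i (by simp)), rfl⟩
  | insert i s hi ih =>
    intro α hα hp
    have : ∀ j, IsProbabilityMeasure (mixture σ r Δt (α j)) := fun j =>
      isProbabilityMeasure_mixture (hα j)
    have := isProbabilityMeasure_mixture hα₀
    have upd : ∀ β, (fun j => mixture σ r Δt (Function.update α i β j)) =
        Function.update (fun j => mixture σ r Δt (α j)) i (mixture σ r Δt β) := by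
      intro β; ext1 j
      rcases eq_or_ne j i with rfl | hj
      · simp
      · simp [hj]
    -- Mixing a share `η` of the positive density `α₀` into coordinate `i` makes that density
    -- positive, so the induction hypothesis applies; the product law is affine in `η`.
    have key : ∀ η : ℝ, 0 < η → η < 1 →
        Integrable F (ENNReal.ofReal (1 - η) • Measure.pi (fun j => mixture σ r Δt (α j)) +
          ENNReal.ofReal η • Measure.pi
            (Function.update (fun j => mixture σ r Δt (α j)) i (mixture σ r Δt α₀))) ∧
        ∫ y, F y ∂(ENNReal.ofReal (1 - η) • Measure.pi (fun j => mixture σ r Δt (α j)) +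
          ENNReal.ofReal η • Measure.pi
            (Function.update (fun j => mixture σ r Δt (α j)) i (mixture σ r Δt α₀))) ≤ V := by
      intro η h0 h1
      have hcomb := (hα i).combination hα₀ (a := 1 - η) (b := η) (by linarith) h0.le (by ring)
      have := ih (Function.update α i fun p => (1 - η) * α i p + η * α₀ p)
        (fun j => by
          rcases eq_or_ne j i with rfl | hj
          · simpa using hcomb
          · simpa [hj] using hα j)
        (fun j hj p => by
          rcases eq_or_ne j i with rfl | hji
          · simp only [Function.update_self]
            exact add_pos_of_nonneg_of_pos (mul_nonneg (by linarith) ((hα j).nonneg p))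
              (mul_pos h0 (hpos p))
          · simpa [hji] using hp j (by simp [hji, hj]) p)
      have hpm := isProbabilityMeasure_mixture hcomb
      rw [mixture_combination (hα i) hα₀ (by linarith) h0.le] at hpm
      rw [upd, mixture_combination (hα i) hα₀ (by linarith) h0.le, pi_update_combination,
        Function.update_eq_self] at this
      exact this
    -- Integrability under a sum of measures passes to each summand; any `η` strictly between zero
    -- and one would do.
    have hintB : Integrable F (Measure.pi fun j => mixture σ r Δt (α j)) := by
      have := (integrable_add_measure.1 (key (1 / 2) (by norm_num) (by norm_num)).1).1
      rwa [integrable_smul_measure (by norm_num) (by simp)] at this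
    have hintA : Integrable F (Measure.pi
        (Function.update (fun j => mixture σ r Δt (α j)) i (mixture σ r Δt α₀))) := by
      have := (integrable_add_measure.1 (key (1 / 2) (by norm_num) (by norm_num)).1).2
      rwa [integrable_smul_measure (by norm_num) (by simp)] at this
    refine ⟨hintB, ?_⟩
    have hle : ∀ η : ℝ, 0 < η → η < 1 →
        (1 - η) * ∫ y, F y ∂(Measure.pi fun j => mixture σ r Δt (α j)) + η * ∫ y, F y ∂(Measure.pi
          (Function.update (fun j => mixture σ r Δt (α j)) i (mixture σ r Δt α₀))) ≤ V := by
      intro η h0 h1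
      have := (key η h0 h1).2
      rwa [integral_add_measure (hintB.smul_measure (by simp)) (hintA.smul_measure (by simp)),
        integral_smul_measure, integral_smul_measure, ENNReal.toReal_ofReal (by linarith),
        ENNReal.toReal_ofReal h0.le] at this
    set x := ∫ y, F y ∂(Measure.pi fun j => mixture σ r Δt (α j))
    set z := ∫ y, F y ∂(Measure.pi
      (Function.update (fun j => mixture σ r Δt (α j)) i (mixture σ r Δt α₀)))
    have hlim : Filter.Tendsto (fun η : ℝ => (1 - η) * x + η * z) (nhdsWithin 0 (Set.Ioi 0))
        (nhds x) := by
      have : Continuous fun η : ℝ => (1 - η) * x + η * z := by fun_prop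
      simpa using (this.tendsto 0).mono_left nhdsWithin_le_nhds
    refine le_of_tendsto hlim ?_
    filter_upwards [Ioo_mem_nhdsGT (zero_lt_one (α := ℝ))] with η hη using hle η hη.1 hη.2

end Closure

/-! ### Freezing the later increments; integrals over shifted intervals. -/

section Shift

/-- Fixing all but the first coordinate of a product law. -/
lemma exists_shift_integral_le {n : ℕ} (q : Fin (n + 1) → Measure ℝ)
    [∀ i, IsProbabilityMeasure (q i)] {g T : ℝ → ℝ} {δ V : ℝ}
    (hT : ∀ j : Fin n, ∀ᵐ y ∂(q j.succ), |T y| ≤ δ)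
    (hint : Integrable (fun y => g (y 0 + ∑ j : Fin n, T (y j.succ))) (Measure.pi q))
    (hle : ∫ y, g (y 0 + ∑ j : Fin n, T (y j.succ)) ∂(Measure.pi q) ≤ V) :
    ∃ τ, |τ| ≤ n * δ ∧ Integrable (fun t => g (t + τ)) (q 0) ∧ ∫ t, g (t + τ) ∂(q 0) ≤ V := by
  have hmp := measurePreserving_piFinSuccAbove q 0
  set ν := Measure.pi fun j : Fin n => q ((0 : Fin (n + 1)).succAbove j) with hν
  set F' : ℝ × (Fin n → ℝ) → ℝ := fun p => g (p.1 + ∑ j, T (p.2 j)) with hF'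
  have hF : (fun y : Fin (n + 1) → ℝ => g (y 0 + ∑ j : Fin n, T (y j.succ))) =
      F' ∘ MeasurableEquiv.piFinSuccAbove (fun _ => ℝ) 0 := by
    ext y
    simp [hF', MeasurableEquiv.piFinSuccAbove, Fin.tail]
  rw [hF] at hint
  have hint' : Integrable F' ((q 0).prod ν) :=
    (hmp.integrable_comp_emb (MeasurableEquiv.measurableEmbedding _)).1 hint
  have hle' : ∫ u, ∫ t, F' (t, u) ∂(q 0) ∂ν ≤ V := by
    rw [← integral_prod_symm _ hint', ← hmp.integral_comp (MeasurableEquiv.measurableEmbedding _)]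
    exact (congrArg (fun G => ∫ y, G y ∂(Measure.pi q)) hF).symm.le.trans hle
  have hae : ∀ᵐ u ∂ν, Integrable (fun t => F' (t, u)) (q 0) := hint'.prod_left_ae
  have hae' : ∀ᵐ u ∂ν, ∀ j, |T (u j)| ≤ δ := by
    refine eventually_all.2 fun j => ?_
    have := hT j
    exact (Measure.quasiMeasurePreserving_eval
      (fun j : Fin n => q ((0 : Fin (n + 1)).succAbove j)) j).ae (by simpa using this)
  -- Some choice `u` of later increments outside the exceptional null set has inner integral at most
  -- the average.
  obtain ⟨u, hu, hu'⟩ := exists_notMem_null_le_integral hint'.integral_prod_right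
    (ae_iff.1 (hae.and hae'))
  simp only [Set.mem_ofPred_eq, not_not] at hu
  refine ⟨∑ j, T (u j), ?_, hu.1, hu'.trans hle'⟩
  calc |∑ j, T (u j)| ≤ ∑ j, |T (u j)| := Finset.abs_sum_le_sum_abs _ _
    _ ≤ ∑ _j : Fin n, δ := Finset.sum_le_sum fun j _ => hu.2 j
    _ = n * δ := by simp

/-- Continuity of the primitive at both endpoints; the margin `ε` keeps shifted endpoints where `g`
is known to be integrable. -/
lemma tendsto_integral_shift {g : ℝ → ℝ} {a b ε : ℝ} (hε : 0 < ε) (hab : a ≤ b)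
    (hg : IntervalIntegrable g volume (a - ε) (b + ε)) :
    Tendsto (fun τ => ∫ t in (a + τ)..(b + τ), g t) (𝓝 0) (𝓝 (∫ t in a..b, g t)) := by
  have hu : Set.uIcc (a - ε) (b + ε) = Set.Icc (a - ε) (b + ε) := Set.uIcc_of_le (by linarith)
  have hcont := intervalIntegral.continuousOn_primitive_interval' hg Set.left_mem_uIcc
  rw [hu] at hcont
  have hsub : ∀ x y, x ∈ Set.Icc (a - ε) (b + ε) → y ∈ Set.Icc (a - ε) (b + ε) →
      IntervalIntegrable g volume x y := fun x y hx hy =>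
    hg.mono_set (by rw [hu]; exact Set.uIcc_subset_Icc hx hy)
  have hlim : ∀ x, a - ε < x → x < b + ε →
      Tendsto (fun τ => ∫ t in (a - ε)..(x + τ), g t) (𝓝 0) (𝓝 (∫ t in (a - ε)..x, g t)) := by
    intro x hx hx'
    have h1 := (hcont.continuousAt (Icc_mem_nhds hx hx')).tendsto
    have h2 : Tendsto (fun τ : ℝ => x + τ) (𝓝 0) (𝓝 x) := by
      simpa using tendsto_const_nhds.add (tendsto_id (x := 𝓝 (0 : ℝ)))
    exact h1.comp h2
  have hl : a - ε ∈ Set.Icc (a - ε) (b + ε) := ⟨le_rfl, by linarith⟩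
  have hmain := (hlim b (by linarith) (by linarith)).sub (hlim a (by linarith) (by linarith))
  rw [intervalIntegral.integral_interval_sub_left
    (hsub _ _ hl ⟨by linarith, by linarith⟩) (hsub _ _ hl ⟨by linarith, by linarith⟩)] at hmain
  refine hmain.congr' ?_
  filter_upwards [Ioo_mem_nhds (neg_lt_zero.2 hε) hε] with τ hτ
  exact intervalIntegral.integral_interval_sub_left
    (hsub _ _ hl ⟨by linarith [hτ.1], by linarith [hτ.2]⟩)
    (hsub _ _ hl ⟨by linarith [hτ.1], by linarith [hτ.2]⟩)

end Shift

/-! ### The inequality for a pair of intervals on opposite sides of `-d`. -/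

section TwoIntervals

variable {σ r Δt S₀ V : ℝ} {f : ℝ → ℝ} {n : ℕ}

lemma price_self {N : ℕ} (y : Fin N → ℝ) :
    price S₀ σ r Δt N y = S₀ * ∏ i, (1 + ret σ r Δt (y i)) := by
  simp only [price, walk, one_add_ret, ← Real.exp_sum, Finset.sum_sub_distrib, Finset.mul_sum]
  simp [mul_assoc]

/-- Since `σ d = -r Δt`, later increments act only by translating the first one, by their deviations
from `-d`. -/
lemma price_succ (hσ : 0 < σ) (y : Fin (n + 1) → ℝ) :
    price S₀ σ r Δt (n + 1) y =
      S₀ * (1 + ret σ r Δt (y 0 + ∑ j : Fin n, (y j.succ + shift σ r Δt))) := by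
  rw [price_self]
  simp only [one_add_ret, ← Real.exp_sum, Fin.sum_univ_succ]
  congr 2
  have : σ * shift σ r Δt = -(r * Δt) := by rw [shift]; field_simp
  simp only [Finset.sum_sub_distrib, Finset.sum_add_distrib, mul_add, Finset.mul_sum, this]
  simp
  ring

/-- The bound for all product measures, applied to laws that are uniform on each of two intervals
in the first period and concentrated near the zero of the return in the others. -/
lemma exists_shift_two_intervals_le (hσ : 0 < σ) (hΔt : 0 < Δt)
    (h : ∀ q : Fin (n + 1) → Measure ℝ, (∀ i, q i ∈ onePeriodMeasures σ r Δt) →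
      Integrable (fun y => f (price S₀ σ r Δt (n + 1) y)) (Measure.pi q) ∧
        ∫ y, f (price S₀ σ r Δt (n + 1) y) ∂(Measure.pi q) ≤ V)
    {a b c d δ : ℝ} (hab : a < b) (hb : b < -shift σ r Δt) (hc : -shift σ r Δt < c)
    (hcd : c < d) (hδ : 0 < δ) :
    ∃ τ, |τ| ≤ δ ∧
      IntervalIntegrable (fun t => f (S₀ * (1 + ret σ r Δt t))) volume (a + τ) (b + τ) ∧
      IntervalIntegrable (fun t => f (S₀ * (1 + ret σ r Δt t))) volume (c + τ) (d + τ) ∧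
      (∫ t in c..d, ret σ r Δt t) * (∫ t in (a + τ)..(b + τ), f (S₀ * (1 + ret σ r Δt t))) +
        (∫ t in a..b, -ret σ r Δt t) * (∫ t in (c + τ)..(d + τ), f (S₀ * (1 + ret σ r Δt t))) ≤
      V * ((b - a) * (∫ t in c..d, ret σ r Δt t) + (d - c) * ∫ t in a..b, -ret σ r Δt t) := by
  obtain ⟨α, k, hα, hk, hP, hM, hk1, hmix⟩ := exists_pairDensity_intervals hσ hΔt hab hb hc hcd
  set H : ℝ → ℝ := fun t => f (S₀ * (1 + ret σ r Δt t)) with hH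
  -- The `n` later deviations, each at most `δ'`, add up to at most `δ`.
  set δ' := δ / (n + 1) with hδ'
  have hδ'0 : 0 < δ' := by positivity
  obtain ⟨β, k', hβ, -, -, -, -, hmix'⟩ := exists_pairDensity_intervals (r := r) hσ hΔt
    (a := -shift σ r Δt - δ') (b := -shift σ r Δt - δ' / 2) (c := -shift σ r Δt + δ' / 2)
    (d := -shift σ r Δt + δ') (by linarith) (by linarith) (by linarith) (by linarith)
  have hγ : ∀ i : Fin (n + 1),
      IsPairDensity σ r Δt ((Fin.cons α fun _ => β : Fin (n + 1) → ℝ × ℝ → ℝ) i) :=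
    Fin.cases hα fun _ => hβ
  have hpm : ∀ i : Fin (n + 1), IsProbabilityMeasure
      (mixture σ r Δt ((Fin.cons α fun _ => β : Fin (n + 1) → ℝ × ℝ → ℝ) i)) :=
    fun i => isProbabilityMeasure_mixture (hγ i)
  obtain ⟨hint, hle⟩ := integrable_and_integral_le_of_pairDensity hσ hΔt h hγ
  simp only [price_succ hσ] at hint hle
  obtain ⟨τ, hτ, hτint, hτle⟩ := exists_shift_integral_le (g := H)
    (T := fun y => y + shift σ r Δt) (δ := δ') _ (fun j => by
      simp only [Fin.cons_succ, hmix']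
      rw [ae_add_measure_iff]
      constructor <;> refine Measure.ae_smul_measure ?_ _ <;>
        filter_upwards [ae_restrict_mem measurableSet_Icc] with y hy <;>
        rw [abs_le] <;> constructor <;> linarith [hy.1, hy.2]) hint hle
  simp only [Fin.cons_zero, hmix] at hτint hτle
  obtain ⟨hi1, hi2⟩ := integrable_add_measure.1 hτint
  rw [integral_add_measure hi1 hi2, integral_smul_measure, integral_smul_measure,
    ENNReal.toReal_ofReal (by positivity), ENNReal.toReal_ofReal (by positivity)] at hτle
  rw [integrable_smul_measure (by simp; positivity) (by simp)] at hi1 hi2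
  simp only [integral_Icc_eq_integral_Ioc, ← intervalIntegral.integral_of_le hab.le,
    ← intervalIntegral.integral_of_le hcd.le, intervalIntegral.integral_comp_add_right,
    smul_eq_mul] at hP hM hk1 hτle
  have hi1' := (intervalIntegrable_iff_integrableOn_Icc_of_le hab.le).2 hi1
  have hi2' := (intervalIntegrable_iff_integrableOn_Icc_of_le hcd.le).2 hi2
  refine ⟨τ, ?_, by simpa using hi1'.comp_sub_right τ, by simpa using hi2'.comp_sub_right τ, ?_⟩
  · refine hτ.trans ?_
    rw [hδ', mul_div_assoc', div_le_iff₀ (by positivity)]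
    nlinarith
  · refine le_of_mul_le_mul_left ?_ hk
    calc _ = _ := by rw [mul_add, ← mul_assoc, ← mul_assoc]
      _ ≤ V := hτle
      _ = _ := by rw [mul_left_comm, hk1, mul_one]

/-- The interval is widened by half its gap to `-d`; shifted by at most that amount it still covers
`[a, b]`. The interval on the other side is arbitrary. -/
lemma intervalIntegrable_payoff (hσ : 0 < σ) (hΔt : 0 < Δt)
    (h : ∀ q : Fin (n + 1) → Measure ℝ, (∀ i, q i ∈ onePeriodMeasures σ r Δt) →
      Integrable (fun y => f (price S₀ σ r Δt (n + 1) y)) (Measure.pi q) ∧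
        ∫ y, f (price S₀ σ r Δt (n + 1) y) ∂(Measure.pi q) ≤ V)
    {a b : ℝ} (hab : a < b) (hD : b < -shift σ r Δt ∨ -shift σ r Δt < a) :
    IntervalIntegrable (fun t => f (S₀ * (1 + ret σ r Δt t))) volume a b := by
  rcases hD with hb | ha
  · obtain ⟨τ, hτ, hi, -, -⟩ := exists_shift_two_intervals_le hσ hΔt h
      (a := a - (-shift σ r Δt - b) / 2) (b := b + (-shift σ r Δt - b) / 2)
      (c := -shift σ r Δt + 1) (d := -shift σ r Δt + 2) (δ := (-shift σ r Δt - b) / 2)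
      (by linarith) (by linarith) (by linarith) (by linarith) (by linarith)
    rw [abs_le] at hτ
    refine hi.mono_set ?_
    rw [Set.uIcc_of_le hab.le, Set.uIcc_of_le (by linarith)]
    exact Set.Icc_subset_Icc (by linarith) (by linarith)
  · obtain ⟨τ, hτ, -, hi, -⟩ := exists_shift_two_intervals_le hσ hΔt h
      (a := -shift σ r Δt - 2) (b := -shift σ r Δt - 1)
      (c := a - (a + shift σ r Δt) / 2) (d := b + (a + shift σ r Δt) / 2)
      (δ := (a + shift σ r Δt) / 2)
      (by linarith) (by linarith) (by linarith) (by linarith) (by linarith)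
    rw [abs_le] at hτ
    refine hi.mono_set ?_
    rw [Set.uIcc_of_le hab.le, Set.uIcc_of_le (by linarith)]
    exact Set.Icc_subset_Icc (by linarith) (by linarith)

lemma two_intervals_le (hσ : 0 < σ) (hΔt : 0 < Δt)
    (h : ∀ q : Fin (n + 1) → Measure ℝ, (∀ i, q i ∈ onePeriodMeasures σ r Δt) →
      Integrable (fun y => f (price S₀ σ r Δt (n + 1) y)) (Measure.pi q) ∧
        ∫ y, f (price S₀ σ r Δt (n + 1) y) ∂(Measure.pi q) ≤ V)
    {a b c d : ℝ} (hab : a < b) (hb : b < -shift σ r Δt) (hc : -shift σ r Δt < c)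
    (hcd : c < d) :
    (∫ t in c..d, ret σ r Δt t) * (∫ t in a..b, f (S₀ * (1 + ret σ r Δt t))) +
        (∫ t in a..b, -ret σ r Δt t) * (∫ t in c..d, f (S₀ * (1 + ret σ r Δt t))) ≤
      V * ((b - a) * (∫ t in c..d, ret σ r Δt t) + (d - c) * ∫ t in a..b, -ret σ r Δt t) := by
  -- Allowing shifts of at most `1 / (k + 1)` and letting `k → ∞` removes the shift.
  choose τ hτ _ _ hle using fun k : ℕ => exists_shift_two_intervals_le hσ hΔt h hab hb hc hcd
    (Nat.one_div_pos_of_nat (n := k) (α := ℝ))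
  have hτ0 : Tendsto τ atTop (𝓝 0) :=
    squeeze_zero_norm hτ tendsto_one_div_add_atTop_nhds_zero_nat
  have h1 := (tendsto_integral_shift (half_pos (sub_pos.2 hb)) hab.le
    (intervalIntegrable_payoff (S₀ := S₀) hσ hΔt h (by linarith)
      (Or.inl (by linarith)))).comp hτ0
  have h2 := (tendsto_integral_shift (half_pos (sub_pos.2 hc)) hcd.le
    (intervalIntegrable_payoff (S₀ := S₀) hσ hΔt h (by linarith)
      (Or.inr (by linarith)))).comp hτ0
  exact le_of_tendsto' ((h1.const_mul _).add (h2.const_mul _)) hle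

end TwoIntervals

/-! ### From interval inequalities to a dominating line. -/

section Line

/-- A separating slope for two families of ratios. -/
lemma exists_slope {ι κ : Type*} [Nonempty ι] [Nonempty κ] {A M : ι → ℝ} {C P : κ → ℝ}
    (hM : ∀ i, 0 < M i) (hP : ∀ j, 0 < P j) (h : ∀ i j, P j * A i + M i * C j ≤ 0) :
    ∃ m, (∀ i, A i ≤ -m * M i) ∧ ∀ j, C j ≤ m * P j := by
  obtain ⟨m, hm⟩ := exists_between_of_forall_le (Set.range_nonempty fun i => A i / M i)
    (Set.range_nonempty fun j => -C j / P j) (by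
      rintro _ ⟨i, rfl⟩ _ ⟨j, rfl⟩
      rw [div_le_div_iff₀ (hM i) (hP j)]
      linarith [h i j])
  refine ⟨-m, fun i => ?_, fun j => ?_⟩
  · have := hm.1 ⟨i, rfl⟩
    rw [div_le_iff₀ (hM i)] at this
    linarith
  · have := hm.2 ⟨j, rfl⟩
    rw [le_div_iff₀ (hP j)] at this
    linarith

/-- Lebesgue differentiation. Integrability is known only away from `D`, so it is applied on the
countably many rational intervals that avoid `D`. -/
lemma ae_nonneg_of_integral_nonneg {k : ℝ → ℝ} {D : ℝ}
    (hi : ∀ a b, a < b → (b < D ∨ D < a) → IntervalIntegrable k volume a b)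
    (hk : ∀ a b, a < b → (b < D ∨ D < a) → 0 ≤ ∫ t in a..b, k t) : ∀ᵐ t, 0 ≤ k t := by
  have hderiv : ∀ᵐ t, ∀ a b : ℚ, (a : ℝ) < b → ((b : ℝ) < D ∨ D < a) → t ∈ Set.uIcc (a : ℝ) b →
      HasDerivAt (fun x => ∫ s in (a : ℝ)..x, k s) (k t) t := by
    refine ae_all_iff.2 fun a => ae_all_iff.2 fun b => ?_
    by_cases h : (a : ℝ) < b ∧ ((b : ℝ) < D ∨ D < a)
    · filter_upwards [(hi a b h.1 h.2).ae_hasDerivAt_integral] with t ht _ _ hm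
      exact ht hm a Set.left_mem_uIcc
    · exact ae_of_all _ fun t h1 h2 => absurd ⟨h1, h2⟩ h
  filter_upwards [hderiv, compl_mem_ae_iff.2 (measure_singleton D)] with t ht htD
  obtain ⟨a, b, hat, htb, hD⟩ : ∃ a b : ℚ, (a : ℝ) < t ∧ t < b ∧ ((b : ℝ) < D ∨ D < a) := by
    rcases lt_or_gt_of_ne (show t ≠ D from htD) with h | h
    · obtain ⟨a, ha⟩ := exists_rat_lt t
      obtain ⟨b, hb, hb'⟩ := exists_rat_btwn h
      exact ⟨a, b, ha, hb, Or.inl hb'⟩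
    · obtain ⟨a, ha, ha'⟩ := exists_rat_btwn h
      obtain ⟨b, hb⟩ := exists_rat_gt t
      exact ⟨a, b, ha', hb, Or.inr ha⟩
  have hd := ht a b (hat.trans htb) hD (by
    rw [Set.uIcc_of_le (hat.trans htb).le]; exact ⟨hat.le, htb.le⟩)
  refine ge_of_tendsto hd.tendsto_slope_zero_right ?_
  filter_upwards [Ioo_mem_nhdsGT (sub_pos.2 htb)] with s hs
  have hDs : ∀ x y : ℝ, a ≤ x → y ≤ b → (y < D ∨ D < x) := fun x y hx hy =>
    hD.imp (fun h => hy.trans_lt h) fun h => h.trans_le hx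
  have hsb : t + s ≤ b := by linarith [hs.2]
  rw [intervalIntegral.integral_interval_sub_left
    (hi _ _ (by linarith [hs.1]) (hDs _ _ le_rfl hsb)) (hi _ _ hat (hDs _ _ le_rfl htb.le))]
  exact smul_nonneg (inv_nonneg.2 hs.1.le)
    (hk _ _ (by linarith [hs.1]) (hDs _ _ hat.le hsb))

variable {σ r Δt S₀ V : ℝ} {f : ℝ → ℝ} {n : ℕ}

/-- The two-interval inequality decouples into one term per interval, so a single slope `m` serves
for all intervals on both sides of `-d`. -/
lemma exists_ae_le_line (hσ : 0 < σ) (hΔt : 0 < Δt)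
    (h : ∀ q : Fin (n + 1) → Measure ℝ, (∀ i, q i ∈ onePeriodMeasures σ r Δt) →
      Integrable (fun y => f (price S₀ σ r Δt (n + 1) y)) (Measure.pi q) ∧
        ∫ y, f (price S₀ σ r Δt (n + 1) y) ∂(Measure.pi q) ≤ V) :
    ∃ m, ∀ᵐ t, f (S₀ * (1 + ret σ r Δt t)) ≤ V + m * ret σ r Δt t := by
  set H : ℝ → ℝ := fun t => f (S₀ * (1 + ret σ r Δt t)) with hH
  set D := -shift σ r Δt with hD
  have hret : ∀ a b, IntervalIntegrable (ret σ r Δt) volume a b := fun a b =>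
    continuous_ret.intervalIntegrable a b
  have hP : ∀ p : {p : ℝ × ℝ // D < p.1 ∧ p.1 < p.2},
      0 < ∫ t in p.1.1..p.1.2, ret σ r Δt t := fun p =>
    intervalIntegral.intervalIntegral_pos_of_pos_on (hret _ _)
      (fun z hz => (ret_pos_iff hσ z).2 (p.2.1.trans hz.1)) p.2.2
  have hM : ∀ p : {p : ℝ × ℝ // p.1 < p.2 ∧ p.2 < D},
      0 < ∫ t in p.1.1..p.1.2, -ret σ r Δt t := fun p =>
    intervalIntegral.intervalIntegral_pos_of_pos_on (hret _ _).neg (fun z hz =>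
      neg_pos.2 ((ret_neg_iff hσ z).2 (hz.2.trans p.2.2))) p.2.1
  have : Nonempty {p : ℝ × ℝ // D < p.1 ∧ p.1 < p.2} := ⟨⟨(D + 1, D + 2), by simp, by simp⟩⟩
  have : Nonempty {p : ℝ × ℝ // p.1 < p.2 ∧ p.2 < D} :=
    ⟨⟨(D - 2, D - 1), by simp, by simp⟩⟩
  obtain ⟨m, hm1, hm2⟩ := exists_slope
    (A := fun p : {p : ℝ × ℝ // p.1 < p.2 ∧ p.2 < D} =>
      (∫ t in p.1.1..p.1.2, H t) - V * (p.1.2 - p.1.1))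
    (C := fun p : {p : ℝ × ℝ // D < p.1 ∧ p.1 < p.2} =>
      (∫ t in p.1.1..p.1.2, H t) - V * (p.1.2 - p.1.1)) hM hP (fun p q => by
        have := two_intervals_le hσ hΔt h p.2.1 p.2.2 q.2.1 q.2.2
        linarith)
  have hHi : ∀ a b, a < b → (b < D ∨ D < a) → IntervalIntegrable H volume a b :=
    fun a b hab hh => intervalIntegrable_payoff hσ hΔt h hab hh
  have hline : ∀ a b, IntervalIntegrable (fun t => V + m * ret σ r Δt t) volume a b := fun a b =>
    intervalIntegrable_const.add ((hret a b).const_mul m)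
  refine ⟨m, ?_⟩
  have hae := ae_nonneg_of_integral_nonneg (k := fun t => V + m * ret σ r Δt t - H t) (D := D)
    (fun a b hab hh => (hline a b).sub (hHi a b hab hh)) (fun a b hab hh => by
      rw [intervalIntegral.integral_sub (hline a b) (hHi a b hab hh),
        intervalIntegral.integral_add intervalIntegrable_const ((hret a b).const_mul m),
        intervalIntegral.integral_const, intervalIntegral.integral_const_mul, smul_eq_mul]
      rcases hh with hb | ha
      · have := hm1 ⟨(a, b), hab, hb⟩
        simp only [intervalIntegral.integral_neg] at this
        linarith
      · have := hm2 ⟨(a, b), ha, hab⟩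
        simp only at this
        linarith)
  filter_upwards [hae] with t ht
  exact sub_nonneg.1 ht

lemma exists_eq_mul_one_add_ret (hσ : 0 < σ) (hS₀ : 0 < S₀) {z : ℝ} (hz : 0 < z) :
    ∃ t, S₀ * (1 + ret σ r Δt t) = z := by
  refine ⟨(Real.log (z / S₀) + r * Δt) / σ, ?_⟩
  rw [one_add_ret, mul_div_cancel₀ _ hσ.ne', add_sub_cancel_right, Real.exp_log (by positivity),
    mul_div_cancel₀ _ hS₀.ne']

/-- Without upward spikes on null sets, an affine bound almost everywhere holds everywhere. -/
lemma NoNullSpikes.le_line (hf : NoNullSpikes f) (hσ : 0 < σ) (hS₀ : 0 < S₀) {m : ℝ}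
    (h : ∀ᵐ t, f (S₀ * (1 + ret σ r Δt t)) ≤ V + m * ret σ r Δt t) {x : ℝ} (hx : 0 < x) :
    f x ≤ V + m * (x / S₀ - 1) := by
  by_contra! hlt
  set ℓ : ℝ → ℝ := fun z => V + m * (z / S₀ - 1) with hℓ
  have hcont : Continuous ℓ := by fun_prop
  have hε : 0 < (f x - ℓ x) / 2 := half_pos (sub_pos.2 hlt)
  obtain ⟨δ, hδ, hball⟩ := Metric.continuousAt_iff.1 hcont.continuousAt _ hε
  set φ : ℝ → ℝ := fun t => S₀ * (1 + ret σ r Δt t) with hφ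
  have hdiff : Differentiable ℝ φ := by
    simp only [hφ, one_add_ret]; fun_prop
  -- The differentiable map from increments to prices preserves null sets, so the prices violating
  -- the line are null, while a violation at `x` would spread to a set of positive measure.
  have hnull := addHaar_image_eq_zero_of_differentiableOn_of_addHaar_eq_zero volume
    hdiff.differentiableOn (ae_iff.1 h)
  refine (hf x hx _ hε _ (lt_min hδ hx)).ne' (measure_mono_null ?_ hnull)
  rintro z ⟨hz1, hz2⟩
  have hzx := abs_lt.1 (hz1.trans_le (min_le_right _ _))
  obtain ⟨t, ht⟩ := exists_eq_mul_one_add_ret (r := r) (Δt := Δt) hσ hS₀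
    (show 0 < z by linarith [hzx.1])
  refine ⟨t, ?_, ht⟩
  have hd := hball (show dist z x < δ from hz1.trans_le (min_le_left _ _))
  rw [Real.dist_eq] at hd
  have hd' := (abs_lt.1 hd).2
  have hret : ret σ r Δt t = z / S₀ - 1 := by
    rw [← ht]; field_simp; ring
  change ¬ f (S₀ * (1 + ret σ r Δt t)) ≤ V + m * ret σ r Δt t
  rw [ht, hret, not_le]
  change ℓ z < f z
  linarith

end Line

/-! ### Branch sums and dominating lines. -/

section Branches

variable {σ r Δt S₀ V : ℝ} {f : ℝ → ℝ} {N : ℕ}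

/-- The probability of branch `i` in a two-point martingale step. -/
noncomputable def branchWeight (σ r Δt : ℝ) (y : Fin 2 → ℝ) (i : Fin 2) : ℝ :=
  |ret σ r Δt (y (i + 1))| / |ret σ r Δt (y (i + 1)) - ret σ r Δt (y i)|

lemma branchSum_eq (hσ : 0 < σ) (y : Fin N → Fin 2 → ℝ) :
    branchSum N S₀ σ r Δt f y = ∑ i : Fin N → Fin 2,
      f (S₀ * ∏ s, (1 + ret σ r Δt (y s (i s)))) * ∏ s, branchWeight σ r Δt (y s) (i s) := by
  have hexp : ∀ x, Real.exp (σ * (shift σ r Δt + x)) = 1 + ret σ r Δt x := by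
    intro x
    rw [one_add_ret, mul_add, shift, mul_div_cancel₀ _ hσ.ne', sub_eq_neg_add]
  simp only [branchSum, branchWeight, hexp, add_sub_cancel_left, add_sub_add_left_eq_sub]

lemma branchWeight_zero (hσ : 0 < σ) {y : Fin 2 → ℝ}
    (hy : y 0 ≤ -shift σ r Δt ∧ -shift σ r Δt < y 1) :
    branchWeight σ r Δt y 0 =
      ret σ r Δt (y 1) / (ret σ r Δt (y 1) - ret σ r Δt (y 0)) := by
  have h0 := (ret_nonpos_iff (r := r) (Δt := Δt) hσ _).2 hy.1
  have h1 := (ret_pos_iff (r := r) (Δt := Δt) hσ _).2 hy.2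
  rw [branchWeight, zero_add, abs_of_pos h1, abs_of_pos (by linarith)]

lemma branchWeight_one (hσ : 0 < σ) {y : Fin 2 → ℝ}
    (hy : y 0 ≤ -shift σ r Δt ∧ -shift σ r Δt < y 1) :
    branchWeight σ r Δt y 1 =
      -ret σ r Δt (y 0) / (ret σ r Δt (y 1) - ret σ r Δt (y 0)) := by
  have h0 := (ret_nonpos_iff (r := r) (Δt := Δt) hσ _).2 hy.1
  have h1 := (ret_pos_iff (r := r) (Δt := Δt) hσ _).2 hy.2
  rw [branchWeight, show (1 : Fin 2) + 1 = 0 from rfl, abs_of_nonpos h0, abs_of_neg (by linarith),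
    neg_sub]

lemma branchWeight_nonneg (y : Fin 2 → ℝ) (i : Fin 2) : 0 ≤ branchWeight σ r Δt y i := by
  unfold branchWeight; positivity

lemma sum_branchWeight (hσ : 0 < σ) {y : Fin 2 → ℝ}
    (hy : y 0 ≤ -shift σ r Δt ∧ -shift σ r Δt < y 1) :
    ∑ i, branchWeight σ r Δt y i = 1 := by
  have h0 := (ret_nonpos_iff (r := r) (Δt := Δt) hσ _).2 hy.1
  have h1 := (ret_pos_iff (r := r) (Δt := Δt) hσ _).2 hy.2
  have : ret σ r Δt (y 1) - ret σ r Δt (y 0) ≠ 0 := by linarith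
  rw [Fin.sum_univ_two, branchWeight_zero hσ hy, branchWeight_one hσ hy]
  field_simp; ring

lemma sum_mul_branchWeight (hσ : 0 < σ) {y : Fin 2 → ℝ}
    (hy : y 0 ≤ -shift σ r Δt ∧ -shift σ r Δt < y 1) :
    ∑ i, (1 + ret σ r Δt (y i)) * branchWeight σ r Δt y i = 1 := by
  have h0 := (ret_nonpos_iff (r := r) (Δt := Δt) hσ _).2 hy.1
  have h1 := (ret_pos_iff (r := r) (Δt := Δt) hσ _).2 hy.2
  have : ret σ r Δt (y 1) - ret σ r Δt (y 0) ≠ 0 := by linarith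
  rw [Fin.sum_univ_two, branchWeight_zero hσ hy, branchWeight_one hσ hy]
  field_simp; ring

/-- The products of branch weights form a probability law under which the price ratio has mean one,
so the slope drops out. -/
lemma branchSum_le (hσ : 0 < σ) (hS₀ : 0 < S₀) {m : ℝ}
    (hf : ∀ x, 0 < x → f x ≤ V + m * (x / S₀ - 1)) {y : Fin N → Fin 2 → ℝ}
    (hy : ∀ s, y s 0 ≤ -shift σ r Δt ∧ -shift σ r Δt < y s 1) :
    branchSum N S₀ σ r Δt f y ≤ V := by
  have hsum : ∀ g : Fin N → Fin 2 → ℝ, (∀ s, ∑ i, g s i = 1) →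
      ∑ i : Fin N → Fin 2, ∏ s, g s (i s) = 1 := by
    intro g hg
    rw [← Fintype.piFinset_univ, ← Finset.prod_univ_sum]
    exact Finset.prod_eq_one fun s _ => hg s
  have h1 := hsum _ fun s => sum_branchWeight hσ (hy s)
  have h2 := hsum _ fun s => sum_mul_branchWeight hσ (hy s)
  simp only [Finset.prod_mul_distrib] at h2
  rw [branchSum_eq hσ]
  calc _ ≤ ∑ i : Fin N → Fin 2, ((V - m) * ∏ s, branchWeight σ r Δt (y s) (i s) +
        m * ((∏ s, (1 + ret σ r Δt (y s (i s)))) * ∏ s, branchWeight σ r Δt (y s) (i s))) := by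
        refine Finset.sum_le_sum fun i _ => ?_
        have hp : 0 < ∏ s, (1 + ret σ r Δt (y s (i s))) :=
          Finset.prod_pos fun s _ => one_add_ret_pos _
        have hw : 0 ≤ ∏ s, branchWeight σ r Δt (y s) (i s) :=
          Finset.prod_nonneg fun s _ => branchWeight_nonneg _ _
        have := mul_le_mul_of_nonneg_right (hf _ (mul_pos hS₀ hp)) hw
        rw [mul_div_cancel_left₀ _ hS₀.ne'] at this
        linarith
    _ = V := by
        rw [Finset.sum_add_distrib, ← Finset.mul_sum, ← Finset.mul_sum, h1, h2]
        ring

/-- Two-point laws in the first period, with all other returns zero, occur among the branches. -/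
lemma two_point_mem_branchValues (hσ : 0 < σ) {n : ℕ} {y : Fin 2 → ℝ}
    (hy : y 0 ≤ -shift σ r Δt ∧ -shift σ r Δt < y 1) :
    ∑ i, f (S₀ * (1 + ret σ r Δt (y i))) * branchWeight σ r Δt y i ∈
      branchValues (n + 1) S₀ σ r Δt f := by
  set D := -shift σ r Δt with hD
  -- The lower point may equal `D`, where the return is zero; it then carries all the weight, and
  -- the upper point is arbitrary.
  set z : Fin 2 → ℝ := ![D, D + 1] with hz
  have hzD : z 0 ≤ D ∧ D < z 1 := by simp [hz]
  have hret : ret σ r Δt (z 0) = 0 := ret_neg_shift hσ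
  have hr1 : 0 < ret σ r Δt (z 1) := (ret_pos_iff hσ _).2 hzD.2
  have hw0 : branchWeight σ r Δt z 0 = 1 := by
    rw [branchWeight_zero hσ hzD, hret, sub_zero, div_self hr1.ne']
  have hw1 : branchWeight σ r Δt z 1 = 0 := by
    rw [branchWeight_one hσ hzD, hret, neg_zero, zero_div]
  refine ⟨Fin.cons y fun _ => z, Fin.cases hy fun _ => hzD, ?_⟩
  rw [branchSum_eq hσ, ← (Fin.consEquiv fun _ => Fin 2).sum_comp, Fintype.sum_prod_type]
  refine Finset.sum_congr rfl fun i _ => ?_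
  rw [Finset.sum_eq_single 0]
  · simp [Fin.prod_univ_succ, Fin.consEquiv, hret, hw0]
  · intro j _ hj
    obtain ⟨s, hs⟩ := Function.ne_iff.1 hj
    have hs1 : j s = 1 := by
      have : j s ≠ 0 := hs
      omega
    have : ∏ s, branchWeight σ r Δt z (j s) = 0 :=
      Finset.prod_eq_zero (Finset.mem_univ s) (by rw [hs1, hw1])
    simp [Fin.prod_univ_succ, Fin.consEquiv, this]
  · simp

lemma exists_line_of_bddAbove_branchValues (hσ : 0 < σ) (hS₀ : 0 < S₀) {n : ℕ} {W : ℝ}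
    (hW : ∀ x ∈ branchValues (n + 1) S₀ σ r Δt f, x ≤ W) :
    ∃ m, ∀ x, 0 < x → f x ≤ W + m * (x / S₀ - 1) := by
  set H : ℝ → ℝ := fun t => f (S₀ * (1 + ret σ r Δt t)) with hH
  have htwo : ∀ a b, ret σ r Δt a ≤ 0 → 0 < ret σ r Δt b →
      ret σ r Δt b * (H a - W) + -ret σ r Δt a * (H b - W) ≤ 0 := by
    intro a b ha hb
    have hy : (![a, b] : Fin 2 → ℝ) 0 ≤ -shift σ r Δt ∧ -shift σ r Δt < ![a, b] 1 :=
      ⟨(ret_nonpos_iff hσ a).1 ha, (ret_pos_iff hσ b).1 hb⟩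
    have := hW _ (two_point_mem_branchValues hσ hy)
    rw [Fin.sum_univ_two, branchWeight_zero hσ hy, branchWeight_one hσ hy] at this
    simp only [Matrix.cons_val_zero, Matrix.cons_val_one] at this
    rw [mul_div_assoc', mul_div_assoc', ← add_div, div_le_iff₀ (by linarith)] at this
    simp only [hH]
    linarith
  -- The prices `2 S₀` and `S₀ / 2` show that both index sets of `exists_slope` are nonempty.
  obtain ⟨b₀, hb₀⟩ := exists_eq_mul_one_add_ret (r := r) (Δt := Δt) hσ hS₀
    (show 0 < S₀ * 2 by positivity)
  have hb₀' : 0 < ret σ r Δt b₀ := by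
    have := mul_left_cancel₀ hS₀.ne' hb₀
    linarith
  obtain ⟨a₀, ha₀⟩ := exists_eq_mul_one_add_ret (r := r) (Δt := Δt) hσ hS₀
    (show 0 < S₀ * (1 / 2) by positivity)
  have ha₀' : ret σ r Δt a₀ < 0 := by
    have := mul_left_cancel₀ hS₀.ne' ha₀
    linarith
  have : Nonempty {a // ret σ r Δt a < 0} := ⟨⟨a₀, ha₀'⟩⟩
  have : Nonempty {b // 0 < ret σ r Δt b} := ⟨⟨b₀, hb₀'⟩⟩
  obtain ⟨m, hm1, hm2⟩ := exists_slope
    (A := fun a : {a // ret σ r Δt a < 0} => H a - W)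
    (C := fun b : {b // 0 < ret σ r Δt b} => H b - W)
    (M := fun a => -ret σ r Δt a) (P := fun b => ret σ r Δt b)
    (fun a => neg_pos.2 a.2) (fun b => b.2) fun a b => htwo a b a.2.le b.2
  refine ⟨m, fun x hx => ?_⟩
  obtain ⟨t, ht⟩ := exists_eq_mul_one_add_ret (r := r) (Δt := Δt) hσ hS₀ hx
  have hret : x / S₀ - 1 = ret σ r Δt t := by
    rw [← ht]; field_simp; ring
  rw [hret]
  have hfx : f x = H t := by simp only [hH, ht]
  rw [hfx]
  rcases lt_trichotomy (ret σ r Δt t) 0 with h | h | h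
  · have := hm1 ⟨t, h⟩
    simp only at this
    linarith
  -- A zero return is not covered by the slope; here the pair inequality against `b₀` alone gives
  -- the bound `W`.
  · have := htwo t b₀ h.le hb₀'
    rw [h, neg_zero, zero_mul, add_zero] at this
    rw [h]
    nlinarith
  · have := hm2 ⟨t, h⟩
    simp only at this
    linarith

end Branches

/-! ### Bounds for expectations under the martingale measures. -/

section Expectations

variable {σ r Δt S₀ : ℝ} {f : ℝ → ℝ} {N : ℕ}

/-- Under a product law the price ratios are independent with mean one, so the line integrates to
`W`. -/
lemma integral_le_of_line (hS₀ : 0 < S₀) {W m : ℝ}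
    (hf : ∀ x, 0 < x → f x ≤ W + m * (x / S₀ - 1)) {Q : Measure (Fin N → ℝ)}
    (hQ : Q ∈ productMeasures N σ r Δt)
    (hint : Integrable (fun y => f (price S₀ σ r Δt N y)) Q) :
    ∫ y, f (price S₀ σ r Δt N y) ∂Q ≤ W := by
  obtain ⟨q, hq, rfl⟩ := hQ
  choose α hα hqα using fun i => mem_onePeriodMeasures_iff.1 (hq i)
  have hd := fun i => (hα i).isPairDensity
  obtain rfl : q = fun i => mixture σ r Δt (α i) := funext hqα
  have : ∀ i, IsProbabilityMeasure (mixture σ r Δt (α i)) := fun i =>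
    isProbabilityMeasure_mixture (hd i)
  have hprod : Integrable (fun y : Fin N → ℝ => ∏ i, (1 + ret σ r Δt (y i)))
      (Measure.pi fun i => mixture σ r Δt (α i)) :=
    Integrable.fintype_prod fun i => integrable_one_add_ret (hd i)
  have hval : ∫ y : Fin N → ℝ, ∏ i, (1 + ret σ r Δt (y i))
      ∂(Measure.pi fun i => mixture σ r Δt (α i)) = 1 := by
    rw [integral_fintype_prod_eq_prod (fun _ t => 1 + ret σ r Δt t)]
    exact Finset.prod_eq_one fun i _ => integral_one_add_ret (hd i)
  calc _ ≤ ∫ y : Fin N → ℝ, ((W - m) + m * ∏ i, (1 + ret σ r Δt (y i)))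
        ∂(Measure.pi fun i => mixture σ r Δt (α i)) := by
        refine integral_mono hint ((integrable_const _).add (hprod.const_mul m)) fun y => ?_
        have hp : 0 < ∏ i, (1 + ret σ r Δt (y i)) :=
          Finset.prod_pos fun i _ => one_add_ret_pos _
        have := hf _ (mul_pos hS₀ hp)
        rw [mul_div_cancel_left₀ _ hS₀.ne'] at this
        simp only [price_self]
        linarith
    _ = W := by
        rw [integral_add (integrable_const _) (hprod.const_mul m), integral_const_mul, hval]
        simp

/-- Bounds for expectations extend from products to their convex span. -/
lemma integral_le_of_mem_martingaleMeasures {F : (Fin N → ℝ) → ℝ} {W : ℝ}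
    (h : ∀ Q ∈ productMeasures N σ r Δt, Integrable F Q ∧ ∫ y, F y ∂Q ≤ W)
    {Q : Measure (Fin N → ℝ)} (hQ : Q ∈ martingaleMeasures N σ r Δt) : ∫ y, F y ∂Q ≤ W := by
  have hconv : Convex NNReal {Q : Measure (Fin N → ℝ) | Integrable F Q ∧ ∫ y, F y ∂Q ≤ W} := by
    rintro Q₁ ⟨hi₁, hl₁⟩ Q₂ ⟨hi₂, hl₂⟩ a b _ _ hab
    have hi₁' : Integrable F (a • Q₁) := hi₁.smul_measure_nnreal
    have hi₂' : Integrable F (b • Q₂) := hi₂.smul_measure_nnreal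
    refine ⟨hi₁'.add_measure hi₂', ?_⟩
    rw [integral_add_measure hi₁' hi₂', integral_smul_nnreal_measure, integral_smul_nnreal_measure]
    have hab' : (a : ℝ) + b = 1 := by exact_mod_cast hab
    have h1 := mul_le_mul_of_nonneg_left hl₁ a.coe_nonneg
    have h2 := mul_le_mul_of_nonneg_left hl₂ b.coe_nonneg
    calc _ ≤ (a : ℝ) * W + b * W := add_le_add h1 h2
      _ = W := by rw [← add_mul, hab', one_mul]
  exact (convexHull_min h hconv hQ).2

lemma nonempty_productMeasures (hσ : 0 < σ) (hΔt : 0 < Δt) :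
    (productMeasures N σ r Δt).Nonempty := by
  obtain ⟨α, hα, hpos⟩ := exists_pos_pairDensity (r := r) hσ hΔt
  exact ⟨_, fun _ => mixture σ r Δt α,
    fun _ => mem_onePeriodMeasures_iff.2 ⟨α, hα.isMixingDensity hpos, rfl⟩, rfl⟩

lemma nonempty_branchValues : (branchValues N S₀ σ r Δt f).Nonempty :=
  ⟨_, fun _ => ![-shift σ r Δt, -shift σ r Δt + 1], fun _ => by simp, rfl⟩

end Expectations

end DiscreteGBM

/-! ### Equality of the two suprema. -/

theorem mainTheorem5 (N : ℕ) (S₀ σ r Δt : ℝ) (hS₀ : 0 < S₀) (hΔt : 0 < Δt) (hσ : 0 < σ)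
    (hσ' : σ < 1 / (2 * Δt)) (f : ℝ → ℝ) (hf : Measurable f)
    (hspike : DiscreteGBM.NoNullSpikes f)
    (hint : ∀ Q ∈ DiscreteGBM.martingaleMeasures N σ r Δt,
      Integrable (fun y => f (DiscreteGBM.price S₀ σ r Δt N y)) Q)
    (hsup : BddAbove (DiscreteGBM.expectations N S₀ σ r Δt f)) :
    BddAbove (DiscreteGBM.branchValues N S₀ σ r Δt f) ∧
      sSup (DiscreteGBM.expectations N S₀ σ r Δt f) =
        sSup (DiscreteGBM.branchValues N S₀ σ r Δt f) := by
  open DiscreteGBM in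
  have hsub : productMeasures N σ r Δt ⊆ martingaleMeasures N σ r Δt := subset_convexHull _ _
  have hne : (expectations N S₀ σ r Δt f).Nonempty := by
    obtain ⟨Q, hQ⟩ := nonempty_productMeasures (N := N) (r := r) hσ hΔt
    exact ⟨_, Q, hsub hQ, rfl⟩
  have hbranch : ∀ x ∈ branchValues N S₀ σ r Δt f,
      x ≤ sSup (expectations N S₀ σ r Δt f) := by
    have hprod : ∀ q : Fin N → Measure ℝ, (∀ i, q i ∈ onePeriodMeasures σ r Δt) →
        Integrable (fun y => f (price S₀ σ r Δt N y)) (Measure.pi q) ∧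
          ∫ y, f (price S₀ σ r Δt N y) ∂(Measure.pi q) ≤ sSup (expectations N S₀ σ r Δt f) :=
      fun q hq => ⟨hint _ (hsub ⟨q, hq, rfl⟩), le_csSup hsup ⟨_, hsub ⟨q, hq, rfl⟩, rfl⟩⟩
    rintro _ ⟨y, hy, rfl⟩
    -- With no periods there is no first step to vary: the only price is `S₀`, and the one branch
    -- sum and the expectation are both `f S₀`.
    rcases N with _ | n
    · have q : Fin 0 → Measure ℝ := fun _ => 0
      have hle := (hprod q fun i => i.elim0).2
      have : ∀ i, IsProbabilityMeasure (q i) := fun i => i.elim0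
      simpa [price_self, branchSum] using hle
    · obtain ⟨m, hm⟩ := exists_ae_le_line hσ hΔt hprod
      exact branchSum_le hσ hS₀ (fun x hx => hspike.le_line hσ hS₀ hm hx) hy
  have hbdd : BddAbove (branchValues N S₀ σ r Δt f) := ⟨_, hbranch⟩
  refine ⟨hbdd, le_antisymm (csSup_le hne ?_) (csSup_le nonempty_branchValues hbranch)⟩
  rintro _ ⟨Q, hQ, rfl⟩
  refine integral_le_of_mem_martingaleMeasures (fun Q hQ => ⟨hint Q (hsub hQ), ?_⟩) hQ
  rcases N with _ | n
  · obtain ⟨q, -, rfl⟩ := hQ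
    have : ∀ i, IsProbabilityMeasure (q i) := fun i => i.elim0
    refine le_csSup hbdd ⟨fun i => i.elim0, fun i => i.elim0, ?_⟩
    simp [branchSum, price_self]
  · obtain ⟨m, hm⟩ := exists_line_of_bddAbove_branchValues hσ hS₀ fun x hx => le_csSup hbdd hx
    exact integral_le_of_line hS₀ hm hQ (hint Q (hsub hQ))
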